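/- A \emph{gyrogroup} is a nonempty set $G$ with a binary operation $\oplus$ such that: (G1) there is a unique element $0\in G$ with $0\oplus a=a=a\oplus 0$ for all $a\in G$; (G2) for every $x\in G$ there is a unique $\ominus x\in G$ with $\ominus x\oplus x=0=x\oplus(\ominus x)$; (G3) for all $x,y\in G$ there is an automorphism $\operatorname{gyr}[x,y]$ of $(G,\oplus)$ such that $x\oplus(y\oplus z)=(x\oplus y)\oplus\operatorname{gyr}[x,y](z)$ for all $z\in G$; (G4) $\operatorname{gyr}[x\oplus y,y]=\operatorname{gyr}[x,y]$ for all $x,y\in G$. A \emph{subgyrogroup} of $G$ is a nonempty subset that is closed under $\oplus$ and is a gyrogroup under the restricted operation; the subgyrogroup $\langle S\rangle$ generated by $S\subseteq G$ is the intersection of all subgyrogroups containing $S$. A \emph{strongly topological gyrogroup} is a gyrogroup $G$ with a topology such that $\oplus\colon G\times G\to G$ and $\ominus\colon G\to G$ are continuous and $0$ has a neighborhood base $\mathscr U$ with $\operatorname{gyr}[x,y](U)=U$ for all $x,y\in G$ and $U\in\mathscr U$. \textbf{Corollary.} Let $G$ be a strongly topological gyrogroup whose underlying space is separable and metrizable.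 Then $G$ has a suitable set, that is, there is a subset $S\subseteq G$ such that the subspace topology on $S$ is discrete, the subgyrogroup $\langle S\rangle$ is dense in $G$, and $S\cup\{0\}$ is closed in $G$. -/

import Mathlib

/-- A gyrogroup, written additively: `a + b` is `a ⊕ b`, `-a` is `⊖ a`, and `gyr x y` is the
gyroautomorphism `gyr[x, y]`, an automorphism of the groupoid `(G, ⊕)`. The identity, the
inverses and the gyroautomorphisms are determined by the operation `⊕` (see
`Gyrogroup.eq_zero_of_identity`, `Gyrogroup.eq_neg_of_add_eq_zero` and `Gyrogroup.gyr_apply`),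
so that carrying them as data adds no structure. -/
class Gyrogroup (G : Type*) extends AddZeroClass G, Neg G where
  neg_add_self : ∀ x : G, -x + x = 0
  add_neg_self : ∀ x : G, x + -x = 0
  gyr : G → G → (G ≃+ G)
  add_add_gyr : ∀ x y z : G, x + (y + z) = (x + y) + gyr x y z
  gyr_add_left : ∀ x y : G, gyr (x + y) y = gyr x y

namespace Gyrogroup

variable {G : Type*} [Gyrogroup G]

/-- The identity element is unique. -/
theorem eq_zero_of_identity (e : G) (h : ∀ a : G, e + a = a ∧ a + e = a) : e = 0 := by
  have := (h 0).1
  rwa [add_zero] at this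

theorem gyr_zero_left (a z : G) : gyr 0 a z = z := by
  have hinj : Function.Injective (fun w : G => a + w) := by
    intro u v huv
    have h : -a + (a + u) = -a + (a + v) := congrArg (fun w => -a + w) huv
    rw [add_add_gyr, add_add_gyr (-a) a v, neg_add_self, zero_add, zero_add] at h
    exact (gyr (-a) a).injective h
  have h := add_add_gyr (0 : G) a z
  rw [zero_add, zero_add] at h
  exact (hinj h).symm

/-- The left cancellation law. -/
theorem neg_add_cancel_left' (a z : G) : -a + (a + z) = z := by
  rw [add_add_gyr, neg_add_self, zero_add, ← gyr_add_left, neg_add_self, gyr_zero_left]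

theorem left_cancel {a u v : G} (h : a + u = a + v) : u = v := by
  rw [← neg_add_cancel_left' a u, h, neg_add_cancel_left']

/-- Inverses are unique. -/
theorem eq_neg_of_add_eq_zero {a b : G} (h : a + b = 0) : b = -a :=
  left_cancel (a := a) (by rw [h, add_neg_self])

theorem neg_neg' (a : G) : -(-a) = a :=
  (eq_neg_of_add_eq_zero (neg_add_self a)).symm

/-- The gyroautomorphisms are determined by the operation. -/
theorem gyr_apply (x y z : G) : gyr x y z = -(x + y) + (x + (y + z)) := by
  rw [add_add_gyr x y z, neg_add_cancel_left']

/-- A nonempty subset `H` of a gyrogroup is a subgyrogroup if it is closed under `⊕` and is a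
gyrogroup under the restricted operation. (The further requirement that each `gyr[x, y]` restricts
to a bijective homomorphism from `H` onto `gyr[x, y](H)` holds for every subset closed under `⊕`,
because `gyr[x, y]` is an injective homomorphism.) -/
structure IsSubgyrogroup (H : Set G) : Prop where
  nonempty : H.Nonempty
  add_mem : ∀ {x y : G}, x ∈ H → y ∈ H → x + y ∈ H
  isGyrogroup : ∃ _ : Gyrogroup H, ∀ x y : H, ((x + y : H) : G) = (x : G) + (y : G)

/-- The subgyrogroup criterion: it is enough that a nonempty subset is closed under `⊕`, `⊖`. -/
theorem isSubgyrogroup_iff {H : Set G} : IsSubgyrogroup H ↔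
    H.Nonempty ∧ (∀ x ∈ H, ∀ y ∈ H, x + y ∈ H) ∧ ∀ x ∈ H, -x ∈ H := by
  constructor
  · rintro ⟨hne, hadd, inst, hinst⟩
    refine ⟨hne, fun x hx y hy => hadd hx hy, fun x hx => ?_⟩
    have h0 : ((0 : H) : G) = 0 := by
      have h : ((0 : H) : G) + ((0 : H) : G) = ((0 : H) : G) + 0 := by
        rw [← hinst, add_zero, add_zero]
      exact left_cancel h
    have h : x + ((-(⟨x, hx⟩ : H) : H) : G) = 0 := by
      have h' := hinst ⟨x, hx⟩ (-⟨x, hx⟩)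
      rw [add_neg_self, h0] at h'
      exact h'.symm
    rw [← eq_neg_of_add_eq_zero h]
    exact Subtype.property _
  · rintro ⟨hne, hadd, hneg⟩
    have h0 : (0 : G) ∈ H := by
      obtain ⟨x, hx⟩ := hne
      rw [← neg_add_self x]
      exact hadd _ (hneg x hx) _ hx
    have hgyr : ∀ x ∈ H, ∀ y ∈ H, ∀ z ∈ H, gyr x y z ∈ H := by
      intro x hx y hy z hz
      rw [gyr_apply]
      exact hadd _ (hneg _ (hadd _ hx _ hy)) _ (hadd _ hx _ (hadd _ hy _ hz))
    have hsymm : ∀ x ∈ H, ∀ y ∈ H, ∀ z ∈ H, (gyr x y).symm z ∈ H := by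
      intro x hx y hy z hz
      have h : (gyr x y).symm z = -y + (-x + ((x + y) + z)) := by
        have h1 := add_add_gyr x y ((gyr x y).symm z)
        rw [AddEquiv.apply_symm_apply] at h1
        rw [← h1, neg_add_cancel_left', neg_add_cancel_left']
      rw [h]
      exact hadd _ (hneg _ hy) _ (hadd _ (hneg _ hx) _ (hadd _ (hadd _ hx _ hy) _ hz))
    refine ⟨hne, fun {x y} hx hy => hadd x hx y hy, ?_⟩
    let _ : Add H := ⟨fun x y => ⟨(x : G) + (y : G), hadd _ x.2 _ y.2⟩⟩
    refine ⟨{ zero := ⟨0, h0⟩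
              neg := fun x => ⟨-x, hneg _ x.2⟩
              zero_add := fun x => Subtype.ext (zero_add (x : G))
              add_zero := fun x => Subtype.ext (add_zero (x : G))
              neg_add_self := fun x => Subtype.ext (neg_add_self (x : G))
              add_neg_self := fun x => Subtype.ext (add_neg_self (x : G))
              gyr := fun x y =>
                { toFun := fun z => ⟨gyr (x : G) (y : G) z, hgyr _ x.2 _ y.2 _ z.2⟩
                  invFun := fun z => ⟨(gyr (x : G) (y : G)).symm z, hsymm _ x.2 _ y.2 _ z.2⟩
                  left_inv := fun z => Subtype.ext (AddEquiv.symm_apply_apply _ _)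
                  right_inv := fun z => Subtype.ext (AddEquiv.apply_symm_apply _ _)
                  map_add' := fun z w => Subtype.ext (map_add (gyr (x : G) (y : G)) (z : G) (w : G)) }
              add_add_gyr := fun x y z => Subtype.ext (add_add_gyr (x : G) y z)
              gyr_add_left := fun x y => AddEquiv.ext fun z => Subtype.ext
                (DFunLike.congr_fun (gyr_add_left (x : G) y) (z : G)) }, fun x y => rfl⟩

/-- The subgyrogroup `⟨S⟩` generated by `S`: the intersection of all subgyrogroups that
contain `S`. -/
def generated (S : Set G) : Set G := ⋂₀ {H : Set G | IsSubgyrogroup H ∧ S ⊆ H}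

theorem isSubgyrogroup_generated (S : Set G) : IsSubgyrogroup (generated S) := by
  rw [isSubgyrogroup_iff]
  refine ⟨⟨0, ?_⟩, ?_, ?_⟩
  · rintro H ⟨hH, -⟩
    obtain ⟨⟨x, hx⟩, hadd, hneg⟩ := isSubgyrogroup_iff.1 hH
    rw [← neg_add_self x]
    exact hadd _ (hneg x hx) _ hx
  · rintro x hx y hy H hH
    exact hH.1.add_mem (hx H hH) (hy H hH)
  · rintro x hx H hH
    exact (isSubgyrogroup_iff.1 hH.1).2.2 x (hx H hH)

end Gyrogroup

/-- A topological gyrogroup: `⊕` is jointly continuous and `⊖` is continuous. -/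
class IsTopologicalGyrogroup (G : Type*) [TopologicalSpace G] [Gyrogroup G] : Prop
    extends ContinuousAdd G, ContinuousNeg G

/-- A strongly topological gyrogroup: a topological gyrogroup in which `0` has a neighborhood
base `𝒰` (of not necessarily open sets) with `gyr[x, y](U) = U` for all `x`, `y` and `U ∈ 𝒰`. -/
class IsStronglyTopologicalGyrogroup (G : Type*) [TopologicalSpace G] [Gyrogroup G] : Prop
    extends IsTopologicalGyrogroup G where
  exists_invariant_base : ∃ 𝒰 : Set (Set G),
    (nhds (0 : G)).HasBasis (fun U => U ∈ 𝒰) id ∧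
    ∀ x y : G, ∀ U ∈ 𝒰, Gyrogroup.gyr x y '' U = U

/-- A suitable set for a topological gyrogroup: it is discrete in itself, generates a dense
subgyrogroup, and becomes closed when `0` is added. -/
structure IsSuitableSet {G : Type*} [TopologicalSpace G] [Gyrogroup G] (S : Set G) : Prop where
  discrete : DiscreteTopology S
  dense_generated : Dense (Gyrogroup.generated S)
  isClosed_union_zero : IsClosed (S ∪ {0})

open Filter Topology Set

namespace Gyrogroup

section Algebra

variable {G : Type*} [Gyrogroup G]

/-! A left translation changes a left difference `-u + v` only by a gyration (`neg_add_eq_gyr`),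
which invariant neighborhoods of `0` do not see, so they behave like a left uniformity. Two cases
arise.

If finitely many translates of some invariant `V` never cover `G`, take a dense sequence `d n` and
choose `g n` so that `g n` and `d n + g n` avoid all `V`-translates of earlier points. The pairs are
uniformly separated, hence locally finite, and each `d n` is recovered from its pair.

Otherwise `G` is totally bounded. For a decreasing invariant base `U n`, finite sets `F n ⊆ U n`
whose `U (n + 1)`-translates cover `U n` form a sequence tending to `0`; adding their elements
successively approximates every point. -/

theorem add_neg_cancel_left' (a z : G) : a + (-a + z) = z := by
  have h := neg_add_cancel_left' (-a) z
  rwa [neg_neg'] at h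

/-- Solving `x + g = b` for the left summand `x`. -/
theorem eq_add_neg_add_add (x g : G) : x = (x + g) + (-((x + g) + g) + (x + g)) := by
  -- By (G4) the gyration is that of `x + g` and `g`, so `x` no longer occurs in it.
  have h : gyr x g (-g) = -((x + g) + g) + (x + g) := by
    rw [← gyr_add_left, gyr_apply, add_neg_self, add_zero]
  rw [← h, ← add_add_gyr, add_neg_self, add_zero]

theorem neg_add_eq_gyr (a u v : G) : -(a + u) + (a + v) = gyr a u (-u + v) := by
  rw [gyr_apply, add_neg_cancel_left']

theorem IsSubgyrogroup.zero_mem {H : Set G} (hH : IsSubgyrogroup H) : (0 : G) ∈ H := by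
  obtain ⟨⟨x, hx⟩, hadd, hneg⟩ := isSubgyrogroup_iff.1 hH
  rw [← neg_add_self x]
  exact hadd _ (hneg x hx) _ hx

theorem IsSubgyrogroup.neg_mem {H : Set G} (hH : IsSubgyrogroup H) {x : G} (hx : x ∈ H) :
    -x ∈ H :=
  (isSubgyrogroup_iff.1 hH).2.2 x hx

theorem IsSubgyrogroup.mem_of_add_mem_right {H : Set G} (hH : IsSubgyrogroup H) {x g : G}
    (hxg : x + g ∈ H) (hg : g ∈ H) : x ∈ H := by
  rw [eq_add_neg_add_add x g]
  exact hH.add_mem hxg (hH.add_mem (hH.neg_mem (hH.add_mem hxg hg)) hxg)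

theorem gyr_mem_of_image_eq {V : Set G} (hV : ∀ x y : G, gyr x y '' V = V) (x y : G) {v : G}
    (hv : v ∈ V) : gyr x y v ∈ V := by
  rw [← hV x y]
  exact mem_image_of_mem _ hv

/-- In a totally bounded gyrogroup every subset is covered by finitely many small left translates
centred in it. -/
theorem exists_finite_subset_cover {W V A : Set G} (hVinv : ∀ x y : G, gyr x y '' V = V)
    (hWV : ∀ a ∈ W, ∀ b ∈ W, -a + b ∈ V) (hcov : ∃ F : Finset G, ∀ x, ∃ f ∈ F, -f + x ∈ W) :
    ∃ F : Set G, F.Finite ∧ F ⊆ A ∧ ∀ a ∈ A, ∃ f ∈ F, -f + a ∈ V := by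
  classical
  obtain ⟨E, hE⟩ := hcov
  have hchoose : ∀ e : G, ∃ b, (∃ a ∈ A, -e + a ∈ W) → b ∈ A ∧ -e + b ∈ W := by
    intro e
    by_cases h : ∃ a ∈ A, -e + a ∈ W
    · obtain ⟨a, ha⟩ := h
      exact ⟨a, fun _ => ha⟩
    · exact ⟨0, fun h' => absurd h' h⟩
  choose b hb using hchoose
  -- Intersecting with `A` discards default values `0` lying outside `A`.
  refine ⟨(b '' (E : Set G)) ∩ A, (E.finite_toSet.image b).subset inter_subset_left,
    inter_subset_right, fun a ha => ?_⟩
  obtain ⟨e, he, hea⟩ := hE a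
  obtain ⟨hbA, hbW⟩ := hb e ⟨a, ha, hea⟩
  refine ⟨b e, ⟨mem_image_of_mem b he, hbA⟩, ?_⟩
  have h := neg_add_eq_gyr e (-e + b e) (-e + a)
  rw [add_neg_cancel_left', add_neg_cancel_left'] at h
  rw [h]
  exact gyr_mem_of_image_eq hVinv _ _ (hWV _ hbW _ hea)

end Algebra

section Topological

variable {G : Type*} [TopologicalSpace G] [Gyrogroup G]

/-- A set that is locally finite away from `0`, and all of whose enclosing subgyrogroups are
dense, yields a suitable set on removing `0`. -/
theorem isSuitableSet_diff_zero [T1Space G] {T : Set G}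
    (hfin : ∀ y : G, y ≠ 0 → ∃ W ∈ 𝓝 y, (W ∩ T).Finite)
    (hdense : ∀ H : Set G, IsSubgyrogroup H → T ⊆ H → Dense H) :
    IsSuitableSet (T \ {0}) := by
  refine ⟨?_, ?_, ?_⟩
  · rw [discreteTopology_subtype_iff]
    rintro y ⟨-, hy0⟩
    obtain ⟨W, hW, hWT⟩ := hfin y hy0
    have hA : ((W ∩ T) \ {y})ᶜ ∈ 𝓝 y :=
      (hWT.subset sdiff_subset).isClosed.isOpen_compl.mem_nhds (by simp)
    rw [← empty_mem_iff_bot]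
    filter_upwards [mem_inf_of_left (mem_nhdsWithin_of_mem_nhds hW),
      mem_inf_of_left (mem_nhdsWithin_of_mem_nhds hA), mem_inf_of_left self_mem_nhdsWithin,
      mem_inf_of_right (mem_principal_self _)] with z hzW hzA hzy hzT
    exact hzA ⟨⟨hzW, hzT.1⟩, hzy⟩
  · have hgen := isSubgyrogroup_generated (T \ {0})
    refine hdense _ hgen fun t ht => ?_
    by_cases h0 : t = 0
    · rw [h0]
      exact hgen.zero_mem
    · exact fun H hH => hH.2 ⟨ht, h0⟩
  · rw [sdiff_union_self, ← isOpen_compl_iff, isOpen_iff_mem_nhds]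
    intro y hy
    have hyT : y ∉ T := fun h => hy (Or.inl h)
    have hy0 : y ≠ 0 := fun h => hy (Or.inr h)
    obtain ⟨W, hW, hWT⟩ := hfin y hy0
    filter_upwards [hW, hWT.isClosed.isOpen_compl.mem_nhds (fun h => hyT h.2),
      isOpen_compl_singleton.mem_nhds hy0] with z hzW hzA hz0
    rintro (hz | hz)
    · exact hzA ⟨hzW, hz⟩
    · exact hz0 hz

variable [IsTopologicalGyrogroup G]

theorem exists_nhds_neg_add_mem (y : G) {V : Set G} (hV : V ∈ 𝓝 (0 : G)) :
    ∃ W ∈ 𝓝 y, ∀ a ∈ W, ∀ b ∈ W, -a + b ∈ V := by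
  have hc : Tendsto (fun p : G × G => -p.1 + p.2) (𝓝 (y, y)) (𝓝 0) := by
    have h : Continuous (fun p : G × G => -p.1 + p.2) := by fun_prop
    simpa [neg_add_self] using h.tendsto (y, y)
  have h := hc hV
  rw [nhds_prod_eq, mem_map, mem_prod_self_iff] at h
  obtain ⟨W, hW, hWV⟩ := h
  exact ⟨W, hW, fun a ha b hb => hWV (mk_mem_prod ha hb)⟩

/-- A subset that is left-close to every point, up to any neighborhood of `0`, is dense. -/
theorem dense_of_forall_neg_add_mem {H : Set G}
    (h : ∀ x : G, ∀ V ∈ 𝓝 (0 : G), ∃ a ∈ H, -a + x ∈ V) : Dense H := by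
  intro x
  rw [mem_closure_iff_nhds]
  intro O hO
  -- With `w = -a + x`, the expression is `a` itself: solve `a + w = x` for `a`.
  have hc : Tendsto (fun w : G => x + (-(x + w) + x)) (𝓝 0) (𝓝 x) := by
    have h : Continuous (fun w : G => x + (-(x + w) + x)) := by fun_prop
    simpa [neg_add_self] using h.tendsto 0
  obtain ⟨a, ha, hax⟩ := h x _ (hc hO)
  refine ⟨a, ?_, ha⟩
  have key := eq_add_neg_add_add a (-a + x)
  rw [add_neg_cancel_left'] at key
  rw [key]
  exact hax

/-- If finitely many left translates of an invariant neighborhood never cover the gyrogroup,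
a suitable set is obtained as a uniformly separated sequence of pairs `g n`, `d n + g n`. -/
theorem exists_isSuitableSet_of_not_covered [T1Space G] [TopologicalSpace.SeparableSpace G]
    {V : Set G} (hV : V ∈ 𝓝 (0 : G)) (hVinv : ∀ x y : G, gyr x y '' V = V)
    (hcov : ∀ F : Finset G, ∃ x, ∀ f ∈ F, -f + x ∉ V) : ∃ S : Set G, IsSuitableSet S := by
  classical
  have : Nonempty G := ⟨0⟩
  let d : ℕ → G := TopologicalSpace.denseSeq G
  have hstep : ∀ (n : ℕ) (F : Finset G),
      ∃ g, ∀ f ∈ F, -f + g ∉ V ∧ -f + (d n + g) ∉ V := by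
    intro n F
    -- Up to a gyration, `d n + g` avoids the translate at `f` exactly when `g` avoids the one at
    -- `-d n + f`.
    obtain ⟨g, hg⟩ := hcov (F ∪ F.image fun f => -d n + f)
    refine ⟨g, fun f hf => ⟨hg f (Finset.mem_union_left _ hf), fun hmem => ?_⟩⟩
    refine hg (-d n + f) (Finset.mem_union_right _ (Finset.mem_image_of_mem _ hf)) ?_
    have h := neg_add_eq_gyr (-d n) f (d n + g)
    rw [neg_add_cancel_left'] at h
    rw [h]
    exact gyr_mem_of_image_eq hVinv _ _ hmem
  choose c hc using hstep
  let F : ℕ → Finset G := fun n =>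
    Nat.rec ∅ (fun k E => E ∪ {c k E, d k + c k E}) n
  let g : ℕ → G := fun n => c n (F n)
  let P : ℕ → Set G := fun n => {g n, d n + g n}
  have hFsucc : ∀ n, F (n + 1) = F n ∪ {g n, d n + g n} := fun n => rfl
  have hFmono : Monotone F := monotone_nat_of_le_succ fun n => by
    rw [hFsucc]
    exact Finset.subset_union_left
  have hsep : ∀ i j, i < j → ∀ a ∈ P i, ∀ b ∈ P j, -a + b ∉ V := by
    intro i j hij a ha b hb
    have haF : a ∈ F j := hFmono (Nat.succ_le_of_lt hij) (by
      rw [Nat.succ_eq_add_one, hFsucc]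
      simp only [Finset.mem_union, Finset.mem_insert, Finset.mem_singleton]
      exact Or.inr ha)
    rcases hb with rfl | hb
    · exact (hc j (F j) a haF).1
    · rw [mem_singleton_iff.1 hb]
      exact (hc j (F j) a haF).2
  refine ⟨_, isSuitableSet_diff_zero (T := ⋃ n, P n) ?_ ?_⟩
  · intro y _
    obtain ⟨W, hW, hWV⟩ := exists_nhds_neg_add_mem y hV
    refine ⟨W, hW, ?_⟩
    rcases (W ∩ ⋃ n, P n).eq_empty_or_nonempty with he | ⟨a, haW, haP⟩
    · rw [he]
      exact finite_empty
    · obtain ⟨i, hai⟩ := mem_iUnion.1 haP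
      -- Left differences within `W` lie in `V`, so `W` meets no pair other than `P i`.
      refine (toFinite (P i)).subset ?_
      rintro b ⟨hbW, hbP⟩
      obtain ⟨j, hbj⟩ := mem_iUnion.1 hbP
      rcases lt_trichotomy i j with h | rfl | h
      · exact absurd (hWV a haW b hbW) (hsep i j h a hai b hbj)
      · exact hbj
      · exact absurd (hWV b hbW a haW) (hsep j i h b hbj a hai)
  · intro H hH hTH
    refine (TopologicalSpace.denseRange_denseSeq G).mono ?_
    rintro _ ⟨n, rfl⟩
    exact hH.mem_of_add_mem_right (g := g n)
      (hTH (mem_iUnion.2 ⟨n, Or.inr rfl⟩)) (hTH (mem_iUnion.2 ⟨n, Or.inl rfl⟩))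

/-- In a totally bounded first-countable gyrogroup with invariant neighborhood base, a suitable
set is obtained as a sequence converging to `0`. -/
theorem exists_isSuitableSet_of_covered [T2Space G] {U : ℕ → Set G}
    (hU : (𝓝 (0 : G)).HasAntitoneBasis U) (hUinv : ∀ n, ∀ x y : G, gyr x y '' U n = U n)
    (hcov : ∀ W ∈ 𝓝 (0 : G), ∃ F : Finset G, ∀ x, ∃ f ∈ F, -f + x ∈ W) :
    ∃ S : Set G, IsSuitableSet S := by
  have hfinite : ∀ (n : ℕ) (A : Set G),
      ∃ F : Set G, F.Finite ∧ F ⊆ A ∧ ∀ a ∈ A, ∃ f ∈ F, -f + a ∈ U n := by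
    intro n A
    -- Covering by the smaller `W` leaves room to move the centres into `A`.
    obtain ⟨W, hW, hWV⟩ := exists_nhds_neg_add_mem (0 : G) (hU.mem n)
    exact exists_finite_subset_cover (hUinv n) hWV (hcov W hW)
  choose E hEfin hEsub hEcov using hfinite
  -- Points of `F n` stay in `U n`, yet reduce an error in `U n` to one in `U (n + 1)`.
  let F : ℕ → Set G := fun n => E (n + 1) (U n)
  refine ⟨_, isSuitableSet_diff_zero (T := E 0 univ ∪ ⋃ n, F n) ?_ ?_⟩
  · intro y hy
    obtain ⟨W, O, hW, hO, hWO⟩ := t2_separation_nhds hy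
    obtain ⟨n, -, hn⟩ := hU.1.mem_iff.1 hO
    -- From stage `n` on, `F k ⊆ U k ⊆ O` misses `W`; only the earlier finite sets remain.
    refine ⟨W, hW, ((hEfin 0 univ).union
      ((finite_lt_nat n).biUnion fun k _ => hEfin (k + 1) (U k))).subset ?_⟩
    rintro z ⟨hzW, hz | hz⟩
    · exact Or.inl hz
    · obtain ⟨k, hk⟩ := mem_iUnion.1 hz
      rcases lt_or_ge k n with hkn | hkn
      · exact Or.inr (mem_biUnion hkn hk)
      · exact absurd (hn (hU.2 hkn (hEsub _ _ hk))) (disjoint_left.1 hWO hzW)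
  · intro H hH hTH
    have happrox : ∀ (x : G) (n : ℕ), ∃ a ∈ H, -a + x ∈ U n := by
      intro x n
      induction n with
      | zero =>
        obtain ⟨f, hf, hfx⟩ := hEcov 0 univ x (mem_univ x)
        exact ⟨f, hTH (Or.inl hf), hfx⟩
      | succ n ih =>
        obtain ⟨a, ha, hax⟩ := ih
        obtain ⟨f, hf, hfx⟩ := hEcov (n + 1) (U n) _ hax
        refine ⟨a + f, hH.add_mem ha (hTH (Or.inr (mem_iUnion.2 ⟨n, hf⟩))), ?_⟩
        -- The new error `-(a + f) + x` is a gyration of `-f + (-a + x)`.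
        have h := neg_add_eq_gyr a f (-a + x)
        rw [add_neg_cancel_left'] at h
        rw [h]
        exact gyr_mem_of_image_eq (hUinv (n + 1)) _ _ hfx
    refine dense_of_forall_neg_add_mem fun x V hV => ?_
    obtain ⟨n, -, hn⟩ := hU.1.mem_iff.1 hV
    obtain ⟨a, ha, hax⟩ := happrox x n
    exact ⟨a, ha, hn hax⟩

end Topological

end Gyrogroup

theorem mainTheorem1 (G : Type*) [TopologicalSpace G] [Gyrogroup G]
    [IsStronglyTopologicalGyrogroup G] [TopologicalSpace.SeparableSpace G]
    [TopologicalSpace.MetrizableSpace G] :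
    ∃ S : Set G, IsSuitableSet S := by
  obtain ⟨𝒰, hbasis, hinv⟩ :=
    IsStronglyTopologicalGyrogroup.exists_invariant_base (G := G)
  by_cases hcov : ∀ V ∈ 𝒰, ∃ F : Finset G, ∀ x, ∃ f ∈ F, -f + x ∈ V
  · obtain ⟨U, hU𝒰, hU⟩ := hbasis.exists_antitone_subbasis
    refine Gyrogroup.exists_isSuitableSet_of_covered hU
      (fun n x y => hinv x y _ (hU𝒰 n)) fun W hW => ?_
    obtain ⟨V, hV, hVW⟩ := hbasis.mem_iff.1 hW
    obtain ⟨F, hF⟩ := hcov V hV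
    refine ⟨F, fun x => ?_⟩
    obtain ⟨f, hf, hfx⟩ := hF x
    exact ⟨f, hf, hVW hfx⟩
  · push Not at hcov
    obtain ⟨V, hV, hVcov⟩ := hcov
    exact Gyrogroup.exists_isSuitableSet_of_not_covered (hbasis.mem_of_mem hV)
      (fun x y => hinv x y V hV) hVcov
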